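/- Let $V$ be a commutative ring and $\mathfrak m\subseteq V$ an ideal with $\mathfrak m^2=\mathfrak m$ such that $\tilde{\mathfrak m}=\mathfrak m\otimes_V\mathfrak m$ is a flat $V$-module. A $V$-linear map $f$ is an \emph{almost isomorphism} if $\tilde{\mathfrak m}\otimes_V f$ is an isomorphism. Almost $V$-algebras, almost modules and their morphisms are represented by honest $V$-algebras, modules and homomorphisms. Let $A$ be a commutative $V$-algebra and $j:I\to A$ a Smith ideal, i.e. a commutative monoid for the push-out product in the category of arrows; explicitly, $I$ is an $A$-module and $j$ is an $A$-linear map (not necessarily injective) with $j(x)y=j(y)x$ for all $x,y\in I$. A \emph{$j$-module} is an $A$-linear map $f:X\to Y$ with an $A$-bilinear action $I\times Y\to X$, $(i,y)\mapsto i\cdot y$, such that $f(i\cdot y)=j(i)y$ and $i\cdot f(x)=j(i)x$; morphisms of $j$-modules are commutative squares compatible with the actions. For $n\ge 0$ let $\mathcal P^n(f)$ be the induced map $X/I^{n+1}Y\to Y/I^{n+1}Y$, where $I^{n+1}Y$ denotes the image of $I^{\otimes_A(n+1)}\otimes_A Y$ in $X$ (respectively in $Y$), and let $\Lambda(f)=\varprojlim_n\mathcal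 P^n(f)$; both are again $j$-modules. Call $f$ \emph{almost complete} if the canonical morphism $\eta:f\to\Lambda(f)$ is an almost isomorphism (on sources and on targets) and an almost analytic equivalence, i.e. $\mathcal P^n(\eta)$ is an almost isomorphism for every $n\ge0$. Assume that $I$ is an almost finitely generated $A$-module: for every finitely generated ideal $\mathfrak m_0\subseteq\mathfrak m$ there is a finitely generated submodule $N\subseteq I$ with $\mathfrak m_0 I\subseteq N$. Then for every $A$-module $M$ the almost nilpotent approximation $$\Lambda_j(M)=\varprojlim_n\bigl(IM/I^{n+1}M\to M/I^{n+1}M\bigr),$$ where $IM$ is the image of $I\otimes_A M\to M$, is almost complete. The same holds for its tensor form $\varprojlim_n\bigl(I/I^{n+1}\otimes_A M\to A/I^{n+1}\otimes_A M\bigr)$, where $I/I^{n+1}$ and $A/I^{n+1}$ are the cokernels of $I^{\otimes_A(n+1)}\to I$ and $I^{\otimes_A(n+1)}\to A$. -/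

import Mathlib

open scoped TensorProduct

namespace AlmostMath

/-! ### Almost isomorphisms and almost finitely generated modules

Objects of the almost category are represented by honest ones: the localization functor from
`V`-modules has the lax symmetric monoidal right adjoint `Hom_V (m ⊗ m, -)`, with invertible counit,
so every almost algebra, every almost module over it and every Smith ideal in almost modules comes
from an honest algebra, module or Smith ideal. Isomorphisms are always taken in the almost sense.
-/

section Basics

variable {V : Type*} [CommRing V]

/-- A homomorphism `f` of `V`-modules is an almost isomorphism (for the ideal `m`) if
`(m ⊗ m) ⊗ f` is an isomorphism of `V`-modules, i.e. if `f` becomes an isomorphism in the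
localization of the category of `V`-modules by the modules killed by `m`. -/
def IsAlmostIso (m : Ideal V) {X Y : Type*} [AddCommGroup X] [Module V X]
    [AddCommGroup Y] [Module V Y] (f : X →ₗ[V] Y) : Prop :=
  Function.Bijective (LinearMap.lTensor (m ⊗[V] m) f)

/-- An `A`-module `I` is almost finitely generated if for every finitely generated ideal
`m₀ ⊆ m` there is a finitely generated `A`-submodule `N` of `I` with `m₀ I ⊆ N`. -/
def IsAlmostFG (m : Ideal V) (A I : Type*) [CommRing A] [Algebra V A] [AddCommGroup I]
    [Module V I] [Module A I] : Prop :=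
  ∀ m₀ : Ideal V, m₀ ≤ m → m₀.FG →
    ∃ N : Submodule A I, N.FG ∧ ∀ ε ∈ m₀, ∀ x : I, ε • x ∈ N

end Basics

/-! ### Inverse limits of quotients by a decreasing filtration -/

section Limits

variable {A X : Type*} [CommRing A] [AddCommGroup X] [Module A X]

/-- The inverse limit of the quotients `X ⧸ F n`, `n = 0, 1, 2, …`, for a decreasing family of
submodules `F n`. -/
def limQuot (F : ℕ → Submodule A X) (hF : Antitone F) : Submodule A (∀ n, X ⧸ F n) where
  carrier := {x | ∀ a b (h : a ≤ b), Submodule.factor (hF h) (x b) = x a}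
  add_mem' hx hy a b h := by simp [hx a b h, hy a b h]
  zero_mem' a b h := by simp
  smul_mem' c x hx a b h := by simp [hx a b h]

/-- The canonical map from `X` to the inverse limit of the `X ⧸ F n`. -/
def limQuotOf (F : ℕ → Submodule A X) (hF : Antitone F) : X →ₗ[A] limQuot F hF :=
  LinearMap.codRestrict _ (LinearMap.pi fun n => (F n).mkQ) fun _ _ _ _ => rfl

end Limits

/-! ### Smith ideals and their modules -/

section Smith

/-- A Smith ideal `j : I → A`: a commutative monoid in the category of arrows with the push-out
product. Spelled out, a multiplication `j □ j → j` together with its unit makes `A` a commutative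
ring and `I` an `A`-module with `j` linear, and the two maps `I ⊗ A → I`, `A ⊗ I → I` (both given
by the module structure) agree on `I ⊗ I`, which is the equation `j x • y = j y • x`. The map `j`
need not be injective. -/
structure SmithIdeal (A I : Type*) [CommRing A] [AddCommGroup I] [Module A I] where
  /-- the underlying arrow -/
  hom : I →ₗ[A] A
  hom_smul_comm : ∀ x y : I, hom x • y = hom y • x

variable {A I : Type*} [CommRing A] [AddCommGroup I] [Module A I]

/-- The image of `j` in `A`. The image of `I^{⊗ n} → A` is the power `j.image ^ n`. -/
def SmithIdeal.image (j : SmithIdeal A I) : Ideal A := LinearMap.range j.hom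

/-- A module over the Smith ideal `j : I → A` with respect to the push-out product: an arrow
`X → Y` of `A`-modules together with an action `I ⊗ Y → X` that is compatible with `j`. -/
structure SmithModule (j : SmithIdeal A I) (X Y : Type*) [AddCommGroup X] [Module A X]
    [AddCommGroup Y] [Module A Y] where
  /-- the underlying arrow -/
  hom : X →ₗ[A] Y
  /-- the action of `I` -/
  act : I →ₗ[A] Y →ₗ[A] X
  hom_act : ∀ i y, hom (act i y) = j.hom i • y
  act_hom : ∀ i x, act i (hom x) = j.hom i • x

namespace SmithModule

variable {j : SmithIdeal A I}
variable {X Y : Type*} [AddCommGroup X] [Module A X] [AddCommGroup Y] [Module A Y]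
variable {X' Y' : Type*} [AddCommGroup X'] [Module A X'] [AddCommGroup Y'] [Module A Y']

/-- The image of `I^{⊗ (n+1)} ⊗ Y → X`. The last factor `I` acts through `I ⊗ Y → X`, the other
`n` factors act on `X` through `j`. -/
def filX (T : SmithModule j X Y) (n : ℕ) : Submodule A X :=
  j.image ^ n • Submodule.span A {x | ∃ i y, T.act i y = x}

/-- The image `I^{n+1} Y` of `I^{⊗ (n+1)} ⊗ Y → Y`. -/
def filY (_T : SmithModule j X Y) (n : ℕ) : Submodule A Y :=
  j.image ^ (n + 1) • (⊤ : Submodule A Y)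

theorem filX_antitone (T : SmithModule j X Y) : Antitone T.filX := fun _ _ h =>
  Submodule.smul_mono_left (Ideal.pow_le_pow_right h)

theorem filY_antitone (T : SmithModule j X Y) : Antitone T.filY := fun _ _ h =>
  Submodule.smul_mono_left (Ideal.pow_le_pow_right (Nat.succ_le_succ h))

theorem filX_le (T : SmithModule j X Y) (n : ℕ) : T.filX n ≤ (T.filY n).comap T.hom := by
  rw [← Submodule.map_le_iff_le_comap, filX, Submodule.map_smul'', filY, pow_succ,
    Submodule.mul_smul]
  refine smul_mono_right _ ?_
  rw [Submodule.map_span_le]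
  rintro _ ⟨i, y, rfl⟩
  rw [T.hom_act]
  exact Submodule.smul_mem_smul ⟨i, rfl⟩ trivial

theorem filY_le (T : SmithModule j X Y) (n : ℕ) (i : I) :
    T.filY n ≤ (T.filX n).comap (T.act i) := by
  rw [← Submodule.map_le_iff_le_comap, filY, Submodule.map_smul'', filX]
  refine (Submodule.smul_mono_left (Ideal.pow_le_pow_right n.le_succ)).trans
    (smul_mono_right _ ?_)
  rintro _ ⟨y, -, rfl⟩
  exact Submodule.subset_span ⟨i, y, rfl⟩

/-- The nilpotent approximation `P^n` of degree `n`: the arrow `X / I^{n+1} Y → Y / I^{n+1} Y`,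
where `I^{n+1} Y` stands for the images of `I^{⊗ (n+1)} ⊗ Y` in `X` and in `Y`. -/
def P (T : SmithModule j X Y) (n : ℕ) : SmithModule j (X ⧸ T.filX n) (Y ⧸ T.filY n) where
  hom := (T.filX n).mapQ (T.filY n) T.hom (T.filX_le n)
  act :=
    { toFun := fun i => (T.filY n).mapQ (T.filX n) (T.act i) (T.filY_le n i)
      map_add' := fun i i' => by ext y; simp
      map_smul' := fun a i => by ext y; simp }
  hom_act i y := by
    obtain ⟨y, rfl⟩ := Submodule.Quotient.mk_surjective _ y
    simp [T.hom_act]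
  act_hom i x := by
    obtain ⟨x, rfl⟩ := Submodule.Quotient.mk_surjective _ x
    simp [T.act_hom]

/-- The nilpotent approximation `Λ(T) = lim P^n(T)`, the inverse limit over all `n ≥ 0`. (The
localization from modules to almost modules preserves limits and colimits, so this also represents
the limit in the category of almost modules.) -/
def approx (T : SmithModule j X Y) :
    SmithModule j (limQuot T.filX T.filX_antitone) (limQuot T.filY T.filY_antitone) where
  hom :=
    { toFun := fun x => ⟨fun n => (T.P n).hom (x.1 n), fun a b h => by
        have e := x.2 a b h
        obtain ⟨z, hz⟩ := Submodule.Quotient.mk_surjective _ (x.1 b)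
        rw [← hz] at e
        simp only [← hz, ← e]
        rfl⟩
      map_add' := fun x y => by ext n; simp
      map_smul' := fun c x => by ext n; simp }
  act := LinearMap.mk₂ A
    (fun i y => ⟨fun n => (T.P n).act i (y.1 n), fun a b h => by
        have e := y.2 a b h
        obtain ⟨z, hz⟩ := Submodule.Quotient.mk_surjective _ (y.1 b)
        rw [← hz] at e
        simp only [← hz, ← e]
        rfl⟩)
    (fun i i' y => by ext n; simp) (fun c i y => by ext n; simp)
    (fun i y y' => by ext n; simp) (fun c i y => by ext n; simp)
  hom_act i y := by
    ext n; exact (T.P n).hom_act i (y.1 n)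
  act_hom i x := by
    ext n; exact (T.P n).act_hom i (x.1 n)

/-- Morphisms of modules over a Smith ideal: commutative squares compatible with the actions. -/
structure Hom (T : SmithModule j X Y) (T' : SmithModule j X' Y') where
  /-- the map of sources -/
  left : X →ₗ[A] X'
  /-- the map of targets -/
  right : Y →ₗ[A] Y'
  comm : ∀ x, T'.hom (left x) = right (T.hom x)
  left_act : ∀ i y, left (T.act i y) = T'.act i (right y)

theorem Hom.filX_le {T : SmithModule j X Y} {T' : SmithModule j X' Y'} (φ : Hom T T') (n : ℕ) :
    T.filX n ≤ (T'.filX n).comap φ.left := by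
  rw [← Submodule.map_le_iff_le_comap, filX, Submodule.map_smul'', filX]
  refine smul_mono_right _ ?_
  rw [Submodule.map_span_le]
  rintro _ ⟨i, y, rfl⟩
  exact Submodule.subset_span ⟨i, φ.right y, (φ.left_act i y).symm⟩

theorem Hom.filY_le {T : SmithModule j X Y} {T' : SmithModule j X' Y'} (φ : Hom T T') (n : ℕ) :
    T.filY n ≤ (T'.filY n).comap φ.right := by
  rw [← Submodule.map_le_iff_le_comap, filY, Submodule.map_smul'', filY]
  exact smul_mono_right _ le_top

/-- The morphism `P^n(φ) : P^n(T) → P^n(T')`. -/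
def Hom.P {T : SmithModule j X Y} {T' : SmithModule j X' Y'} (φ : Hom T T') (n : ℕ) :
    Hom (T.P n) (T'.P n) where
  left := (T.filX n).mapQ (T'.filX n) φ.left (φ.filX_le n)
  right := (T.filY n).mapQ (T'.filY n) φ.right (φ.filY_le n)
  comm x := by
    obtain ⟨x, rfl⟩ := Submodule.Quotient.mk_surjective _ x
    simp [SmithModule.P, φ.comm]
  left_act i y := by
    obtain ⟨y, rfl⟩ := Submodule.Quotient.mk_surjective _ y
    simp [SmithModule.P, φ.left_act]

/-- The canonical morphism `T → Λ(T)`. -/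
def toApprox (T : SmithModule j X Y) : Hom T T.approx where
  left := limQuotOf T.filX T.filX_antitone
  right := limQuotOf T.filY T.filY_antitone
  comm _ := rfl
  left_act _ _ := rfl

section Almost

variable {V : Type*} [CommRing V] [Algebra V A] (m : Ideal V)
  [Module V X] [IsScalarTower V A X] [Module V Y] [IsScalarTower V A Y]
  [Module V X'] [IsScalarTower V A X'] [Module V Y'] [IsScalarTower V A Y']

/-- A morphism of arrows is an almost isomorphism if it is one on sources and on targets. -/
def Hom.IsAlmostIso {T : SmithModule j X Y} {T' : SmithModule j X' Y'} (φ : Hom T T') : Prop :=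
  AlmostMath.IsAlmostIso m (φ.left.restrictScalars V) ∧
    AlmostMath.IsAlmostIso m (φ.right.restrictScalars V)

/-- `φ` is an almost analytic equivalence if `P^n(φ)` is an almost isomorphism for all `n ≥ 0`. -/
def Hom.IsAlmostAnalyticEquiv {T : SmithModule j X Y} {T' : SmithModule j X' Y'}
    (φ : Hom T T') : Prop :=
  ∀ n : ℕ, (φ.P n).IsAlmostIso m

/-- `T` is almost complete if the canonical morphism `T → Λ(T)` is an almost isomorphism and an
almost analytic equivalence. -/
def IsAlmostComplete (T : SmithModule j X Y) : Prop :=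
  T.toApprox.IsAlmostIso m ∧ T.toApprox.IsAlmostAnalyticEquiv m

end Almost

end SmithModule

namespace SmithIdeal

variable (j : SmithIdeal A I) (M : Type*) [AddCommGroup M] [Module A M]

/-- The arrow `j ⊗ M : I ⊗_A M → M`, `i ⊗ x ↦ j(i) x`. -/
def tensorArrow : SmithModule j (I ⊗[A] M) M where
  hom := TensorProduct.lift ((LinearMap.lsmul A M).comp j.hom)
  act := TensorProduct.mk A I M
  hom_act i y := by simp
  act_hom i t := by
    induction t with
    | zero => simp
    | add s t hs ht => simp only [map_add, smul_add, hs, ht]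
    | tmul i' y =>
      simp only [TensorProduct.lift.tmul, LinearMap.comp_apply, LinearMap.lsmul_apply,
        TensorProduct.mk_apply, TensorProduct.tmul_smul, TensorProduct.smul_tmul']
      rw [j.hom_smul_comm]

/-- The submodule `I M` of `M`, the image of `j ⊗ M : I ⊗_A M → M`. -/
def mulModule : Submodule A M := LinearMap.range (j.tensorArrow M).hom

/-- The arrow `I M → M`, the inclusion of the image of `j ⊗ M`. -/
def imageArrow : SmithModule j (j.mulModule M) M where
  hom := (j.mulModule M).subtype
  act := LinearMap.mk₂ A
    (fun i y => ⟨j.hom i • y, i ⊗ₜ y, by simp [tensorArrow]⟩)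
    (fun i i' y => by ext; simp [add_smul]) (fun c i y => by ext; simp [mul_smul])
    (fun i y y' => by ext; simp) (fun c i y => by ext; exact smul_comm _ _ _)
  hom_act _ _ := rfl
  act_hom _ _ := rfl

/-- The almost nilpotent approximation `Λ_j(M)` of `M`: the inverse limit of the arrows
`I M / I^{n+1} M → M / I^{n+1} M`. -/
abbrev almostApprox := (j.imageArrow M).approx

/-- The tensor form of `Λ_j(M)`: the inverse limit of the arrows
`I / I^{n+1} ⊗ M → A / I^{n+1} ⊗ M`, in which `I ⊗_A M` is not replaced by its image in `M`. -/
abbrev almostTensorApprox := (j.tensorArrow M).approx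

end SmithIdeal

end Smith

end AlmostMath

/-! The point is to compare `I^(n+1)Λ` with the kernel `K_n` of the projection from `Λ` to its
`n`-th quotient. Always `I^(n+1)Λ ⊆ K_n`; almost finite generation gives `m K_n ⊆ I^(n+1)Λ`.

For the latter, telescope an element of `K_n` into a series with terms in `I · I^k Y`. For `ε ∈ m`,
one finite family `g_s` spans a submodule containing `εI`, so `ε` times each term is `∑ g_s d_{k,s}`
with `d_{k,s} ∈ I^k Y`. Summing over `k` first gives `ε x = ∑ g_s z_s` with `z_s` in the limit, one
filtration step lower (`exists_sum_of_mem_limQuotFil`). Iterating costs `n+1` factors from `m`,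
which is harmless since `m^(n+1) = m`.

It follows that `η : Λ → lim Λ/I^(n+1)Λ` is injective with cokernel killed by `m`, and so is each
`P^n(η)`; flatness of `m ⊗ m` makes such maps almost isomorphisms. Only the module structure over
`j` is used, so both forms of `Λ_j(M)` are instances. -/

namespace AlmostMath

section Basics

variable {V : Type*} [CommRing V]

/-- If `m² = m` and `m ⊗ m` is flat, then an injective map with cokernel killed by `m` is an almost
isomorphism. -/
theorem isAlmostIso_of_injective {m : Ideal V} (hm : m * m = m) (hflat : Module.Flat V (m ⊗[V] m))
    {X Y : Type*} [AddCommGroup X] [Module V X] [AddCommGroup Y] [Module V Y] {f : X →ₗ[V] Y}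
    (hf : Function.Injective f) (hcoker : ∀ ε ∈ m, ∀ y, ε • y ∈ LinearMap.range f) :
    IsAlmostIso m f := by
  refine ⟨Module.Flat.lTensor_preserves_injective_linearMap f hf, ?_⟩
  rw [← LinearMap.range_eq_top, eq_top_iff]
  rintro t -
  induction t with
  | zero => exact zero_mem _
  | add s t hs ht => exact add_mem hs ht
  | tmul s y =>
    induction s with
    | zero => simp
    | add s t hs ht => rw [TensorProduct.add_tmul]; exact add_mem hs ht
    | tmul a b =>
      -- Since `m = m²`, the first tensor factor is a sum of products `p q`; moving `p` across to
      -- `y` lands in the range of `f`.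
      have key : ∀ c (hc : c ∈ m * m),
          ((⟨c, hm.le hc⟩ : m) ⊗ₜ[V] b) ⊗ₜ[V] y ∈ LinearMap.range (f.lTensor (m ⊗[V] m)) := by
        intro c hc
        induction hc using Submodule.mul_induction_on' with
        | mem_mul_mem p hp q hq =>
          obtain ⟨x, hx⟩ := hcoker p hp y
          refine ⟨((⟨q, hq⟩ : m) ⊗ₜ[V] b) ⊗ₜ[V] x, ?_⟩
          rw [LinearMap.lTensor_tmul, hx, TensorProduct.tmul_smul, TensorProduct.smul_tmul',
            TensorProduct.smul_tmul']
          rfl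
        | add p hp q hq h₁ h₂ =>
          have := add_mem h₁ h₂
          rwa [← TensorProduct.add_tmul, ← TensorProduct.add_tmul] at this
      exact key a (hm.ge a.2)

end Basics

/-! ### Series in inverse limits and finite families of coefficients -/

section Limits

variable {A X : Type*} [CommRing A] [AddCommGroup X] [Module A X]

/-- The decreasing filtration of the inverse limit of the `X ⧸ F n` by the elements whose first `n`
components vanish. -/
def limQuotFil (F : ℕ → Submodule A X) (hF : Antitone F) (n : ℕ) : Submodule A (limQuot F hF) where
  carrier := {x | ∀ l < n, x.1 l = 0}
  add_mem' hx hy l h := by simp [hx l h, hy l h]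
  zero_mem' l h := by simp
  smul_mem' c x hx l h := by simp [hx l h]

theorem mem_limQuotFil_succ {F : ℕ → Submodule A X} {hF : Antitone F} {n : ℕ}
    {x : limQuot F hF} : x ∈ limQuotFil F hF (n + 1) ↔ x.1 n = 0 := by
  refine ⟨fun h => h n n.lt_succ_self, fun h l hl => ?_⟩
  rw [← x.2 l n (Nat.lt_succ_iff.1 hl), h, map_zero]

/-- The sum of a series whose `k`-th term lies in `F (k - 1)`. -/
def limQuotSum (F : ℕ → Submodule A X) (hF : Antitone F) (z : ℕ → X)
    (hz : ∀ k, z (k + 1) ∈ F k) : limQuot F hF :=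
  ⟨fun n => (F n).mkQ (∑ k ∈ Finset.range (n + 1), z k), fun a b h => by
    induction b, h using Nat.le_induction with
    | base => rfl
    | succ b hab ih =>
      rw [← ih]
      change (F a).mkQ (∑ k ∈ Finset.range (b + 1 + 1), z k) =
        (F a).mkQ (∑ k ∈ Finset.range (b + 1), z k)
      rw [Finset.sum_range_succ, map_add, add_eq_left, Submodule.mkQ_apply,
        Submodule.Quotient.mk_eq_zero]
      exact hF hab (hz b)⟩

theorem limQuotSum_mem_fil {F : ℕ → Submodule A X} {hF : Antitone F} {z : ℕ → X}
    {hz : ∀ k, z (k + 1) ∈ F k} {n : ℕ} (h : ∀ k < n, z k = 0) :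
    limQuotSum F hF z hz ∈ limQuotFil F hF n := by
  intro l hl
  change (F l).mkQ _ = 0
  rw [Finset.sum_eq_zero, map_zero]
  exact fun k hk => h k (by have := Finset.mem_range.1 hk; omega)

/-- A bilinear map evaluated on the span of a finite family in the first variable. -/
theorem exists_sum_of_mem_map₂ {I Y : Type*} [AddCommGroup I] [Module A I] [AddCommGroup Y]
    [Module A Y] (φ : I →ₗ[A] Y →ₗ[A] X) {r : ℕ} (g : Fin r → I) (D : Submodule A Y) {x : X}
    (hx : x ∈ Submodule.map₂ φ (Submodule.span A (Set.range g)) D) :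
    ∃ d : Fin r → Y, (∀ s, d s ∈ D) ∧ x = ∑ s, φ (g s) (d s) := by
  rw [Submodule.map₂_eq_span_image2] at hx
  induction hx using Submodule.span_induction with
  | mem x hx =>
    obtain ⟨i, hi, y, hy, rfl⟩ := hx
    obtain ⟨c, rfl⟩ := (Submodule.mem_span_range_iff_exists_fun A).1 hi
    exact ⟨fun s => c s • y, fun s => D.smul_mem _ hy, by simp⟩
  | zero => exact ⟨0, fun s => zero_mem _, by simp⟩
  | smul a x _ h =>
    obtain ⟨d, hd, rfl⟩ := h
    exact ⟨a • d, fun s => D.smul_mem _ (hd s), by simp [Finset.smul_sum]⟩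
  | add x x' _ _ h h' =>
    obtain ⟨d, hd, rfl⟩ := h
    obtain ⟨d', hd', rfl⟩ := h'
    exact ⟨d + d', fun s => add_mem (hd s) (hd' s), by simp [Finset.sum_add_distrib]⟩

/-- A completed bilinear map: if `F k` is spanned by the `φ i y` with `y` in the `k`-th step of the
filtration of `Y`, and `a • I` lies in the span of the finite family `g`, then `a` times an element
of the `(n + 1)`-st step of the limit of the `X ⧸ F k` is a combination of the `φ (g s)` with
coefficients in the `n`-th step of the limit of the `Y ⧸ G k`, where `D (k + 1) ≤ G k`. -/
theorem exists_sum_of_mem_limQuotFil {I Y : Type*} [AddCommGroup I] [Module A I] [AddCommGroup Y]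
    [Module A Y] (φ : I →ₗ[A] Y →ₗ[A] X) (F : ℕ → Submodule A X) (hF : Antitone F)
    (D : ℕ → Submodule A Y) (G : ℕ → Submodule A Y) (hG : Antitone G)
    (hDG : ∀ k, D (k + 1) ≤ G k)
    (hFD : ∀ k, F k ≤ Submodule.map₂ φ ⊤ (D k))
    (Φ : I → limQuot G hG → limQuot F hF)
    (hΦ : ∀ i z k y, z.1 k = (G k).mkQ y → (Φ i z).1 k = (F k).mkQ (φ i y))
    {a : A} {r : ℕ} {g : Fin r → I} (hg : ∀ i : I, a • i ∈ Submodule.span A (Set.range g))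
    {n : ℕ} {x : limQuot F hF} (hx : x ∈ limQuotFil F hF (n + 1)) :
    ∃ z : Fin r → limQuot G hG,
      (∀ s, z s ∈ limQuotFil G hG n) ∧ a • x = ∑ s, Φ (g s) (z s) := by
  -- Choosing zero representatives up to index `n` makes the differences vanish for `k < n`, so the
  -- coefficient series start at `n`.
  have hu : ∀ k, ∃ u : X, (F k).mkQ u = x.1 k ∧ (k < n + 1 → u = 0) := by
    intro k
    by_cases hk : k < n + 1
    · exact ⟨0, by rw [hx k hk, map_zero], fun _ => rfl⟩
    · obtain ⟨u, hu⟩ := (F k).mkQ_surjective (x.1 k)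
      exact ⟨u, hu, fun h => absurd h hk⟩
  choose u hu hu0 using hu
  have hdiff : ∀ k, u (k + 1) - u k ∈ F k := by
    intro k
    rw [← Submodule.Quotient.mk_eq_zero, Submodule.Quotient.mk_sub, sub_eq_zero]
    have := x.2 k (k + 1) k.le_succ
    rw [← hu, ← hu] at this
    exact this
  have hd : ∀ k, ∃ d : Fin r → Y, (∀ s, d s ∈ D k) ∧
      a • (u (k + 1) - u k) = ∑ s, φ (g s) (d s) ∧ (k < n → ∀ s, d s = 0) := by
    intro k
    by_cases hk : k < n
    · exact ⟨0, fun s => zero_mem _, by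
        rw [hu0 k (by omega), hu0 (k + 1) (by omega)]; simp, fun _ _ => rfl⟩
    · obtain ⟨d, h₁, h₂⟩ := exists_sum_of_mem_map₂ φ g (D k) (x := a • (u (k + 1) - u k)) (by
        have hx := hFD k (hdiff k)
        rw [Submodule.map₂_eq_span_image2] at hx
        generalize u (k + 1) - u k = x at hx
        induction hx using Submodule.span_induction with
        | mem x hx =>
          obtain ⟨i, -, y, hy, rfl⟩ := hx
          rw [← LinearMap.smul_apply, ← map_smul]
          exact Submodule.apply_mem_map₂ _ (hg i) hy
        | zero => simp
        | smul b x _ h => rw [smul_comm]; exact Submodule.smul_mem _ b h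
        | add x x' _ _ h h' => rw [smul_add]; exact add_mem h h')
      exact ⟨d, h₁, h₂, fun h => absurd h hk⟩
  choose d hdD hd hd0 using hd
  refine ⟨fun s => limQuotSum G hG (fun k => d k s) fun k => hDG k (hdD _ s),
    fun s => limQuotSum_mem_fil fun k hk => hd0 k hk s, ?_⟩
  ext k
  have e₁ : (∑ s, Φ (g s) (limQuotSum G hG (fun k => d k s) fun k => hDG k (hdD _ s))).1 k =
      (F k).mkQ (∑ s, φ (g s) (∑ l ∈ Finset.range (k + 1), d l s)) := by
    rw [AddSubmonoidClass.coe_finsetSum, Finset.sum_apply, map_sum]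
    exact Finset.sum_congr rfl fun s _ => hΦ _ _ _ _ rfl
  -- The partial sum over `range (k + 1)` telescopes to `u (k + 1)`, which agrees with `u k` modulo
  -- `F k`.
  have e₂ : (a • x).1 k = (F k).mkQ (a • u (k + 1)) := by
    change a • x.1 k = _
    rw [← hu, ← map_smul, ← sub_eq_zero, ← map_sub, ← smul_sub, Submodule.mkQ_apply,
      Submodule.Quotient.mk_eq_zero, ← neg_sub, smul_neg, neg_mem_iff]
    exact (F k).smul_mem _ (hdiff k)
  rw [e₁, e₂]
  congr 1
  simp only [map_sum]
  rw [Finset.sum_comm, ← Finset.sum_congr rfl fun l _ => hd l, ← Finset.smul_sum,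
    Finset.sum_range_sub, hu0 0 (by omega), sub_zero]

end Limits

/-! ### Completeness from comparing two filtrations -/

section Complete

variable {V : Type*} [CommRing V] {A X : Type*} [CommRing A] [Algebra V A] [AddCommGroup X]
  [Module A X] [Module V X] [IsScalarTower V A X]

/-- If `G n` lies in the kernel of the projection of the limit of the `X ⧸ F k` to `X ⧸ F n`, then
that limit injects into the limit of its own quotients by the `G n`. -/
theorem limQuotOf_injective {F : ℕ → Submodule A X} {hF : Antitone F}
    {G : ℕ → Submodule A (limQuot F hF)} (hG : Antitone G)
    (hGF : ∀ n, G n ≤ limQuotFil F hF (n + 1)) : Function.Injective (limQuotOf G hG) := by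
  refine (injective_iff_map_eq_zero _).2 fun x hx => ?_
  ext n
  refine mem_limQuotFil_succ.1 (hGF n ?_)
  rw [← Submodule.Quotient.mk_eq_zero]
  exact congrFun (congrArg Subtype.val hx) n

/-- If moreover `G n` contains `m` times the kernel of the projection to `X ⧸ F n`, then the
cokernel of the map to the limit of the quotients by the `G n` is killed by `m`. -/
theorem smul_mem_range_limQuotOf {m : Ideal V} {F : ℕ → Submodule A X} {hF : Antitone F}
    {G : ℕ → Submodule A (limQuot F hF)} (hG : Antitone G)
    (hGF : ∀ n, G n ≤ limQuotFil F hF (n + 1))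
    (hFG : ∀ n, ∀ ε ∈ m, ∀ x ∈ limQuotFil F hF (n + 1), ε • x ∈ G n)
    {ε : V} (hε : ε ∈ m) (w : limQuot G hG) : ε • w ∈ LinearMap.range (limQuotOf G hG) := by
  have hv : ∀ n, ∃ v, (G n).mkQ v = w.1 n := fun n => (G n).mkQ_surjective _
  choose v hv using hv
  have hvv : ∀ a b, a ≤ b → v b - v a ∈ G a := by
    intro a b h
    have := w.2 a b h
    rw [← hv, ← hv] at this
    rw [← Submodule.Quotient.mk_eq_zero, Submodule.Quotient.mk_sub, sub_eq_zero]
    exact this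
  have hval : ∀ a b, a ≤ b → (v b).1 a = (v a).1 a := by
    intro a b h
    exact sub_eq_zero.1 (mem_limQuotFil_succ.1 (hGF a (hvv a b h)))
  -- Diagonal element: `y - v n` dies in `X ⧸ F n`, so `m` multiplies it into `G n`.
  obtain ⟨y, hy⟩ : ∃ y : limQuot F hF, ∀ n, y.1 n = (v n).1 n :=
    ⟨⟨fun n => (v n).1 n, fun a b h => by rw [(v b).2 a b h, hval a b h]⟩, fun _ => rfl⟩
  refine ⟨ε • y, ?_⟩
  ext n
  change (G n).mkQ (ε • y) = ε • w.1 n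
  rw [← hv, Submodule.mkQ_apply, Submodule.mkQ_apply, ← Submodule.Quotient.mk_smul,
    Submodule.Quotient.eq]
  have := hFG n ε hε (y - v n) (mem_limQuotFil_succ.2 (sub_eq_zero.2 (hy n)))
  rwa [smul_sub] at this

/-- If the cokernel of `X → lim X ⧸ G n` is killed by `m`, then `X ⧸ G n` is almost the quotient of
the limit by any submodule between the image of `G n` and the kernel of the projection. -/
theorem isAlmostIso_mapQ_limQuotOf {m : Ideal V} (hm : m * m = m)
    (hflat : Module.Flat V (m ⊗[V] m)) {G : ℕ → Submodule A X} {hG : Antitone G}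
    (hcoker : ∀ ε ∈ m, ∀ w : limQuot G hG, ε • w ∈ LinearMap.range (limQuotOf G hG)) {n : ℕ}
    {H : Submodule A (limQuot G hG)} (hH : H ≤ limQuotFil G hG (n + 1))
    (hGH : G n ≤ H.comap (limQuotOf G hG)) :
    IsAlmostIso m (((G n).mapQ H (limQuotOf G hG) hGH).restrictScalars V) := by
  refine isAlmostIso_of_injective hm hflat ?_ fun ε hε w => ?_
  · change Function.Injective ((G n).mapQ H (limQuotOf G hG) hGH)
    rw [← LinearMap.ker_eq_bot, LinearMap.ker_eq_bot']
    intro x hx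
    obtain ⟨x, rfl⟩ := Submodule.Quotient.mk_surjective _ x
    rw [Submodule.mapQ_apply, Submodule.Quotient.mk_eq_zero] at hx
    exact mem_limQuotFil_succ.1 (hH hx)
  · obtain ⟨w, rfl⟩ := Submodule.Quotient.mk_surjective _ w
    obtain ⟨x, hx⟩ := hcoker ε hε w
    refine ⟨Submodule.Quotient.mk x, ?_⟩
    change Submodule.Quotient.mk (limQuotOf G hG x) = _
    rw [hx, Submodule.Quotient.mk_smul]

end Complete

/-! ### The filtration by powers of `I` on the nilpotent approximation -/

namespace SmithModule

variable {A I : Type*} [CommRing A] [AddCommGroup I] [Module A I] {j : SmithIdeal A I}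
variable {X Y : Type*} [AddCommGroup X] [Module A X] [AddCommGroup Y] [Module A Y]

/-- One factor `I` is split off and the other `k` are moved through the action onto `Y`, as the
series argument requires. -/
theorem filX_le_map₂ (T : SmithModule j X Y) (k : ℕ) :
    T.filX k ≤ Submodule.map₂ T.act ⊤ (j.image ^ k • ⊤) := by
  rw [filX, Submodule.smul_le]
  intro c hc x hx
  induction hx using Submodule.span_induction with
  | mem x hx =>
    obtain ⟨i, y, rfl⟩ := hx
    rw [← map_smul]
    exact Submodule.apply_mem_map₂ _ trivial (Submodule.smul_mem_smul hc trivial)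
  | zero => simp
  | add x y _ _ hx hy => rw [smul_add]; exact add_mem hx hy
  | smul a x _ hx => rw [smul_comm]; exact Submodule.smul_mem _ _ hx

theorem filY_le_map₂ (T : SmithModule j X Y) (k : ℕ) :
    T.filY k ≤ Submodule.map₂ ((LinearMap.lsmul A Y).comp j.hom) ⊤ (j.image ^ k • ⊤) := by
  rw [filY, pow_succ', Submodule.mul_smul, Submodule.smul_le]
  rintro _ ⟨i, rfl⟩ y hy
  exact Submodule.apply_mem_map₂ ((LinearMap.lsmul A Y).comp j.hom) trivial hy

theorem approx_filY_le (T : SmithModule j X Y) (n : ℕ) :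
    T.approx.filY n ≤ limQuotFil T.filY T.filY_antitone (n + 1) := by
  rw [filY, Submodule.smul_le]
  intro c hc y _
  rw [mem_limQuotFil_succ]
  change c • y.1 n = 0
  obtain ⟨w, hw⟩ := (T.filY n).mkQ_surjective (y.1 n)
  rw [← hw, ← map_smul, Submodule.mkQ_apply, Submodule.Quotient.mk_eq_zero]
  exact Submodule.smul_mem_smul hc trivial

theorem approx_filX_le (T : SmithModule j X Y) (n : ℕ) :
    T.approx.filX n ≤ limQuotFil T.filX T.filX_antitone (n + 1) := by
  rw [filX, Submodule.smul_le]
  intro c hc x hx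
  rw [mem_limQuotFil_succ]
  change c • x.1 n = 0
  induction hx using Submodule.span_induction with
  | mem x hx =>
    obtain ⟨i, y, rfl⟩ := hx
    obtain ⟨w, hw⟩ := (T.filY n).mkQ_surjective (y.1 n)
    change c • (T.P n).act i (y.1 n) = 0
    rw [← hw]
    change (T.filX n).mkQ (c • T.act i w) = 0
    rw [Submodule.mkQ_apply, Submodule.Quotient.mk_eq_zero]
    exact Submodule.smul_mem_smul hc (Submodule.subset_span ⟨i, w, rfl⟩)
  | zero => simp
  | add x y _ _ hx hy =>
    change c • (x.1 n + y.1 n) = 0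
    rw [smul_add, hx, hy, add_zero]
  | smul a x _ hx =>
    change c • a • x.1 n = 0
    rw [smul_comm, hx, smul_zero]

theorem act_mem_filX (T : SmithModule j X Y) (n : ℕ) (i : I) {y : Y}
    (hy : y ∈ j.image ^ n • (⊤ : Submodule A Y)) : T.act i y ∈ T.filX n := by
  have : (j.image ^ n • (⊤ : Submodule A Y)).map (T.act i) ≤ T.filX n := by
    rw [Submodule.map_smul'', filX]
    refine smul_mono_right _ ?_
    rintro _ ⟨y, -, rfl⟩
    exact Submodule.subset_span ⟨i, y, rfl⟩
  exact this ⟨y, hy, rfl⟩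

section Almost

variable {V : Type*} [CommRing V] [Algebra V A] {m : Ideal V} [Module V I] [IsScalarTower V A I]
  [Module V Y] [IsScalarTower V A Y]

theorem exists_finite_family (hI : IsAlmostFG m A I) {ε : V} (hε : ε ∈ m) :
    ∃ (r : ℕ) (g : Fin r → I),
      ∀ i : I, algebraMap V A ε • i ∈ Submodule.span A (Set.range g) := by
  obtain ⟨N, hN, h⟩ := hI (Ideal.span {ε}) ((Ideal.span_singleton_le_iff_mem _).2 hε)
    ⟨{ε}, by simp⟩
  obtain ⟨r, g, rfl⟩ := Submodule.fg_iff_exists_fin_generating_family.1 hN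
  exact ⟨r, g, fun i => by
    rw [algebraMap_smul]; exact h ε (Ideal.mem_span_singleton_self ε) i⟩

/-- Each step extracts one factor of `I` at the price of one factor of `m`; at `n = 0` both powers
are trivial. -/
theorem smul_mem_of_mem_fil (T : SmithModule j X Y) (hI : IsAlmostFG m A I) (n : ℕ) :
    ∀ ε ∈ m ^ n, ∀ y ∈ limQuotFil T.filY T.filY_antitone n,
      ε • y ∈ j.image ^ n • (⊤ : Submodule A (limQuot T.filY T.filY_antitone)) := by
  induction n with
  | zero => simp
  | succ n ih =>
    intro ε hε y hy
    rw [pow_succ] at hε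
    induction hε using Submodule.mul_induction_on' with
    | mem_mul_mem δ hδ ε hε =>
      obtain ⟨r, g, hg⟩ := exists_finite_family hI hε
      obtain ⟨z, hz, e⟩ := exists_sum_of_mem_limQuotFil
        ((LinearMap.lsmul A Y).comp j.hom) T.filY T.filY_antitone (fun k => j.image ^ k • ⊤)
        T.filY T.filY_antitone (fun _ => le_rfl) T.filY_le_map₂ (fun i z => j.hom i • z)
        (fun i z k y h => by
          change j.hom i • z.1 k = _
          rw [h]; rfl) hg hy
      rw [mul_smul, ← algebraMap_smul A ε, e, Finset.smul_sum]
      refine Submodule.sum_mem _ fun s _ => ?_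
      rw [smul_comm, pow_succ', Submodule.mul_smul]
      exact Submodule.smul_mem_smul ⟨g s, rfl⟩ (ih δ hδ _ (hz s))
    | add a ha b hb h h' => rw [add_smul]; exact add_mem h h'

theorem pow_succ_eq_of_mul_self (hm : m * m = m) (n : ℕ) : m ^ (n + 1) = m := by
  induction n with
  | zero => rw [zero_add, pow_one]
  | succ n ih => rw [pow_succ, ih, hm]

theorem smul_mem_approx_filY (T : SmithModule j X Y) (hm : m * m = m) (hI : IsAlmostFG m A I)
    (n : ℕ) : ∀ ε ∈ m, ∀ y ∈ limQuotFil T.filY T.filY_antitone (n + 1),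
      ε • y ∈ T.approx.filY n := fun ε hε =>
  T.smul_mem_of_mem_fil hI (n + 1) ε (by rwa [pow_succ_eq_of_mul_self hm])

variable [Module V X] [IsScalarTower V A X]

/-- A single extraction along the action passes from `X` to `Y`; the remaining `n` factors come from
the result for `Y`. -/
theorem smul_mem_approx_filX (T : SmithModule j X Y) (hm : m * m = m) (hI : IsAlmostFG m A I)
    (n : ℕ) : ∀ ε ∈ m, ∀ x ∈ limQuotFil T.filX T.filX_antitone (n + 1),
      ε • x ∈ T.approx.filX n := by
  intro ε hε x hx
  rw [← pow_succ_eq_of_mul_self hm n, pow_succ] at hε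
  induction hε using Submodule.mul_induction_on' with
  | mem_mul_mem δ hδ ε hε =>
    obtain ⟨r, g, hg⟩ := exists_finite_family hI hε
    obtain ⟨z, hz, e⟩ := exists_sum_of_mem_limQuotFil T.act T.filX T.filX_antitone
      (fun k => j.image ^ k • ⊤) T.filY T.filY_antitone (fun _ => le_rfl) T.filX_le_map₂
      (fun i z => T.approx.act i z)
      (fun i z k y h => by
        change (T.P k).act i (z.1 k) = _
        rw [h]; rfl) hg hx
    rw [mul_smul, ← algebraMap_smul A ε, e, Finset.smul_sum]
    refine Submodule.sum_mem _ fun s _ => ?_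
    rw [← algebraMap_smul A δ, ← map_smul, algebraMap_smul]
    exact T.approx.act_mem_filX n (g s) (T.smul_mem_of_mem_fil hI n δ hδ _ (hz s))
  | add a ha b hb h h' => rw [add_smul]; exact add_mem h h'

/-- If `I` is almost finitely generated, then the nilpotent approximation of every module over the
Smith ideal is almost complete. -/
theorem approx_isAlmostComplete (T : SmithModule j X Y) (hm : m * m = m)
    (hflat : Module.Flat V (m ⊗[V] m)) (hI : IsAlmostFG m A I) : T.approx.IsAlmostComplete m := by
  have hX := limQuotOf_injective T.approx.filX_antitone T.approx_filX_le
  have hY := limQuotOf_injective T.approx.filY_antitone T.approx_filY_le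
  have hX' := fun (ε : V) (hε : ε ∈ m) => smul_mem_range_limQuotOf T.approx.filX_antitone
    T.approx_filX_le (T.smul_mem_approx_filX hm hI) hε
  have hY' := fun (ε : V) (hε : ε ∈ m) => smul_mem_range_limQuotOf T.approx.filY_antitone
    T.approx_filY_le (T.smul_mem_approx_filY hm hI) hε
  exact ⟨⟨isAlmostIso_of_injective hm hflat hX hX', isAlmostIso_of_injective hm hflat hY hY'⟩,
    -- For `P^n(η)`, the easy inclusion is applied to `Λ(Λ(T))`, and the cokernel bound is that of
    -- `η`.
    fun n => ⟨isAlmostIso_mapQ_limQuotOf hm hflat hX' (T.approx.approx_filX_le n)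
        (T.approx.toApprox.filX_le n),
      isAlmostIso_mapQ_limQuotOf hm hflat hY' (T.approx.approx_filY_le n)
        (T.approx.toApprox.filY_le n)⟩⟩

end Almost

end SmithModule

end AlmostMath

open scoped TensorProduct in
theorem mainTheorem4 {V : Type*} [CommRing V] (m : Ideal V) (hm : m * m = m)
    (hflat : Module.Flat V (m ⊗[V] m))
    {A : Type*} [CommRing A] [Algebra V A]
    {I : Type*} [AddCommGroup I] [Module V I] [Module A I] [IsScalarTower V A I]
    (j : AlmostMath.SmithIdeal A I) (hI : AlmostMath.IsAlmostFG m A I)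
    (M : Type*) [AddCommGroup M] [Module V M] [Module A M] [IsScalarTower V A M] :
    (j.almostApprox M).IsAlmostComplete m ∧ (j.almostTensorApprox M).IsAlmostComplete m :=
  ⟨(j.imageArrow M).approx_isAlmostComplete hm hflat hI,
    (j.tensorArrow M).approx_isAlmostComplete hm hflat hI⟩
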